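/- Let $n\ge 3$ and $1\le k\le n$, and let $G$ be the ring (cycle) graph on the agents $N=\{1,\dots,n\}$. In the graphical coordination game $(G,\alpha)$ with payoff gain $\alpha\in\mathbb{R}$, every agent plays $x$ or $y$, and agent $i$ has utility $U_i(a)=\sum_{j\in\mathcal N_i}u(a_i,a_j)$, where $\mathcal N_i$ is the set of neighbors of $i$, $u(x,x)=1+\alpha$, $u(y,y)=1$ and $u(x,y)=u(y,x)=0$. An agent in the influence set $S\subseteq N$ of an adversary receives an additional payoff of $1$ whenever it plays $y$; write $\tilde U_i(a,S)$ for the resulting utility. Agents follow log-linear learning with parameter $\beta>0$ against the uniformly random adversary ${\rm UR}(k)$ of capability $k$: at each time $t=0,1,\dots$, with current joint action $a(t)=a$, an agent $i$ is selected uniformly at random, a set $S(t)$ is drawn independently and uniformly from all $k$-element subsets of $N$, and agent $i$ then takes the action $c\in\{x,y\}$ with probability $e^{\beta \tilde U_i((c,a_{-i}),S(t))}/\bigl(e^{\beta \tilde U_i((x,a_{-i}),S(t))}+e^{\beta \tilde U_i((y,a_{-i}),S(t))}\bigr)$, while all other actions stay fixed. A joint action $a$ is called strictly stochastically stable if for every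 $\epsilon>0$ there is $B<\infty$ such that for every $\beta>B$ there is $T<\infty$ with $\Pr[a(t)=a]>1-\epsilon$ for all $t>T$ and every initial joint action $a(0)$. Let $\vec x$ and $\vec y$ be the joint actions in which all agents play $x$ and $y$, respectively. Let $\alpha^{\rm resil}(G,{\rm UR}(k))$ be the infimum of all $\alpha$ for which $\vec x$ is strictly stochastically stable, and $\alpha^{\rm sus}(G,{\rm UR}(k))$ the supremum of all $\alpha$ for which $\vec y$ is strictly stochastically stable. Then $$\alpha^{\rm resil}(G,{\rm UR}(k))=\alpha^{\rm sus}(G,{\rm UR}(k))=\begin{cases}\tfrac12 & \text{if } 1\le k\le n-1,\\ 1 & \text{if } k=n.\end{cases}$$ -/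

import Mathlib

namespace CoordGame

/-- The two alternatives of the coordination game. -/
inductive Action
  | x
  | y
  deriving DecidableEq

instance : Fintype Action where
  elems := {Action.x, Action.y}
  complete := by
    intro c
    cases c <;> simp

/-- A joint action: one action for every agent. -/
abbrev Profile (V : Type*) := V → Action

/-- The joint action in which every agent plays `x`. -/
def allX (V : Type*) : Profile V := fun _ => Action.x

/-- The joint action in which every agent plays `y`. -/
def allY (V : Type*) : Profile V := fun _ => Action.y

/-- The payoff to the first player of the two-player coordination game with payoff gain `α`. -/
def payoff (α : ℝ) : Action → Action → ℝ
  | Action.x, Action.x => 1 + α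
  | Action.y, Action.y => 1
  | Action.x, Action.y => 0
  | Action.y, Action.x => 0

section

variable {V : Type*} [Fintype V] [DecidableEq V]

/-- The utility of agent `i` in the graphical coordination game `(G, α)`: the sum of the payoffs
received in the two-player games played with the neighbors of `i`. -/
def utility (G : SimpleGraph V) [DecidableRel G.Adj] (α : ℝ) (i : V) (a : Profile V) : ℝ :=
  ∑ j ∈ G.neighborFinset i, payoff α (a i) (a j)

/-- The utility of agent `i` when the adversary influences the agents in `S`: an influenced agent
gets an additional payoff of `1` for playing `y`. -/
def influencedUtility (G : SimpleGraph V) [DecidableRel G.Adj] (α : ℝ) (S : Finset V) (i : V)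
    (a : Profile V) : ℝ :=
  utility G α i a + if i ∈ S ∧ a i = Action.y then 1 else 0

/-- Log-linear learning: the probability that agent `i`, selected for an update at the joint
action `a` while the influence set is `S`, chooses the action `c`. -/
noncomputable def choiceProb (G : SimpleGraph V) [DecidableRel G.Adj] (α β : ℝ) (S : Finset V)
    (i : V) (a : Profile V) (c : Action) : ℝ :=
  Real.exp (β * influencedUtility G α S i (Function.update a i c)) /
    (Real.exp (β * influencedUtility G α S i (Function.update a i Action.x)) +
      Real.exp (β * influencedUtility G α S i (Function.update a i Action.y)))

variable (V) in
/-- A (possibly randomized) adversary policy: to the current joint action it assigns the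
probability distribution from which the current influence set is drawn, independently of the
past and of the selection of the updating agent. -/
abbrev Policy := Profile V → stdSimplex ℝ (Finset V)

variable (V) in
/-- The uniformly random adversary with capability `k`: at every joint action, the influence set
is uniformly distributed on the sets of exactly `k` agents. -/
def UR (k : ℕ) : Set (Policy V) :=
  {σ | ∀ (a : Profile V) (S : Finset V),
    σ a S = if S.card = k then 1 / ((Fintype.card V).choose k : ℝ) else 0}

/-- One-step transition probabilities of the joint action: an agent `i` is selected uniformly at
random, the influence set `S` is drawn from the policy, and agent `i` revises its action by
log-linear learning while all other actions remain fixed. -/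
noncomputable def transition (G : SimpleGraph V) [DecidableRel G.Adj] (α β : ℝ) (σ : Policy V) :
    Matrix (Profile V) (Profile V) ℝ :=
  fun a a' => ∑ i : V, 1 / (Fintype.card V : ℝ) *
    ∑ S : Finset V, σ a S *
      ∑ c : Action, if Function.update a i c = a' then choiceProb G α β S i a c else 0

/-- The probability that the joint action at time `t` is `a`, when the initial one is `a₀`. -/
noncomputable def probAt (G : SimpleGraph V) [DecidableRel G.Adj] (α β : ℝ) (σ : Policy V)
    (a₀ : Profile V) (t : ℕ) (a : Profile V) : ℝ :=
  (transition G α β σ ^ t) a₀ a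

/-- Strict stochastic stability of the joint action `a`: from every initial joint action, the
probability of being at `a` exceeds `1 - ε` for all sufficiently large `β` and then, given `β`,
for all sufficiently large times. -/
def StrictlyStochasticallyStable (G : SimpleGraph V) [DecidableRel G.Adj] (α : ℝ) (σ : Policy V)
    (a : Profile V) : Prop :=
  ∀ ε : ℝ, 0 < ε → ∃ B : ℝ, ∀ β : ℝ, B < β → ∃ T : ℕ, ∀ a₀ : Profile V, ∀ t : ℕ, T < t →
    1 - ε < probAt G α β σ a₀ t a

/-- The game `(G, α)` is resilient to a class of adversary policies if every policy of the class
leaves the all-`x` joint action strictly stochastically stable. -/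
def Resilient (G : SimpleGraph V) [DecidableRel G.Adj] (α : ℝ) (type : Set (Policy V)) : Prop :=
  ∀ σ ∈ type, StrictlyStochasticallyStable G α σ (allX V)

/-- The game `(G, α)` is susceptible to a class of adversary policies if some policy of the class
makes the all-`y` joint action strictly stochastically stable. -/
def Susceptible (G : SimpleGraph V) [DecidableRel G.Adj] (α : ℝ) (type : Set (Policy V)) : Prop :=
  ∃ σ ∈ type, StrictlyStochasticallyStable G α σ (allY V)

/-- The infimum of the payoff gains `α` for which `(G, α)` is resilient, as an extended real. -/
noncomputable def alphaResil (G : SimpleGraph V) [DecidableRel G.Adj] (type : Set (Policy V)) :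
    EReal :=
  sInf ((fun α : ℝ => (α : EReal)) '' {α : ℝ | Resilient G α type})

/-- The supremum of the payoff gains `α` for which `(G, α)` is susceptible, as an extended
real. -/
noncomputable def alphaSus (G : SimpleGraph V) [DecidableRel G.Adj] (type : Set (Policy V)) :
    EReal :=
  sSup ((fun α : ℝ => (α : EReal)) '' {α : ℝ | Susceptible G α type})

end

end CoordGame

/-! The argument compares transition costs as exponents in `β`; no stationary distribution is
computed. A consensus is strictly stochastically stable when leaving it costs at least `s`, leaving
the opposite consensus costs at most `r < s`, and from any state where someone already plays its
action it spreads at no cost. Then `n` steps reach it from anywhere with probability at least a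
constant times `exp (-β r)`, while `n` steps lose it with probability at most `n * exp (-β s)`, and
the ratio of the two bounds vanishes as `β` grows (`strictlyStochasticallyStable_of_cost_lt`).

On the ring, the adversary can reduce the exit cost of all-`x` to `1 + 2α`. Leaving all-`y` costs `2
+ e`, where `e` is the least bonus an agent can draw: `1` if `k = n`, otherwise `0`, because some
influence set misses the agent. These costs balance at `α = (1 + e) / 2`. Both consensuses cannot be
stable at once, so stability of one on each side fixes both thresholds. -/

/-! ### Long-run concentration of a finite Markov chain -/

open Filter Topology in
theorem Matrix.exists_forall_lt_pow_apply {ι : Type*} [Fintype ι] [DecidableEq ι]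
    {P : Matrix ι ι ℝ} (hP : P ∈ Matrix.rowStochastic ℝ ι) {a : ι} {N : ℕ} {δ η ε : ℝ}
    (hN : 0 < N) (hδ : 0 < δ) (hη : 0 ≤ η) (hreach : ∀ b, δ ≤ (P ^ N) b a)
    (hstay : 1 - η ≤ (P ^ N) a a) (hε : η / δ < ε) :
    ∃ T : ℕ, ∀ b : ι, ∀ t : ℕ, T < t → 1 - ε < (P ^ t) b a := by
  have hpow : ∀ t, P ^ t ∈ Matrix.rowStochastic ℝ ι := fun t => pow_mem hP t
  have hδ1 : δ ≤ 1 := (hreach a).trans (Matrix.le_one_of_mem_rowStochastic (hpow N))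
  -- Condition on the state at time `t`: at `a` the next `N` steps fail with probability at most
  -- `η`, elsewhere with probability at most `1 - δ`.
  have hrec : ∀ t b, 1 - (P ^ (t + N)) b a ≤ (1 - δ) * (1 - (P ^ t) b a) + η := by
    intro t b
    have hle : (P ^ t) b a ≤ 1 := Matrix.le_one_of_mem_rowStochastic (hpow t)
    have h0 : 0 ≤ (P ^ t) b a := Matrix.nonneg_of_mem_rowStochastic (hpow t)
    have hsum := Matrix.sum_row_of_mem_rowStochastic (hpow t) b
    rw [← Finset.add_sum_erase _ _ (Finset.mem_univ a)] at hsum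
    have key : (P ^ t) b a * (1 - η) + (1 - (P ^ t) b a) * δ ≤ (P ^ (t + N)) b a := by
      rw [pow_add, Matrix.mul_apply, ← Finset.add_sum_erase _ _ (Finset.mem_univ a)]
      refine add_le_add (mul_le_mul_of_nonneg_left hstay h0) ?_
      rw [show 1 - (P ^ t) b a = ∑ c ∈ Finset.univ.erase a, (P ^ t) b c by linarith,
        Finset.sum_mul]
      exact Finset.sum_le_sum fun c _ => mul_le_mul_of_nonneg_left (hreach c)
        (Matrix.nonneg_of_mem_rowStochastic (hpow t))
    nlinarith [mul_nonneg hη (sub_nonneg.2 hle)]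
  -- `η / δ` is the fixed point of `u ↦ (1 - δ) * u + η`; the offset `r` lets one bound serve all
  -- residues of time modulo `N`.
  have hiter : ∀ m r b, 1 - (P ^ (r + N * m)) b a ≤ (1 - δ) ^ m + η / δ := by
    intro m r b
    induction m with
    | zero =>
      have h0 : 0 ≤ (P ^ (r + N * 0)) b a := Matrix.nonneg_of_mem_rowStochastic (hpow _)
      have : 0 ≤ η / δ := by positivity
      simp only [pow_zero]
      linarith
    | succ m ih =>
      have h1 := hrec (r + N * m) b
      have h2 := mul_le_mul_of_nonneg_left ih (sub_nonneg.2 hδ1)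
      have h3 : δ * (η / δ) = η := by field_simp
      rw [show r + N * (m + 1) = r + N * m + N by ring, pow_succ]
      nlinarith
  have hlim : Tendsto (fun m : ℕ => (1 - δ) ^ m) atTop (𝓝 0) :=
    tendsto_pow_atTop_nhds_zero_of_lt_one (sub_nonneg.2 hδ1) (by linarith)
  obtain ⟨M, hM⟩ := eventually_atTop.1 (hlim.eventually (gt_mem_nhds (sub_pos.2 hε)))
  refine ⟨N * M, fun b t ht => ?_⟩
  have h1 := hiter (t / N) (t % N) b
  rw [Nat.mod_add_div] at h1
  have h2 := hM (t / N) ((Nat.le_div_iff_mul_le hN).2 (by rw [mul_comm]; exact ht.le))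
  linarith

/-! ### Transition probabilities of log-linear learning -/

namespace CoordGame

theorem univ_action : (Finset.univ : Finset Action) = {Action.x, Action.y} := rfl

theorem sum_action {M : Type*} [AddCommMonoid M] (f : Action → M) :
    ∑ c, f c = f Action.x + f Action.y := by
  rw [univ_action, Finset.sum_pair (by decide)]

section

variable {V : Type*} [Fintype V] [DecidableEq V] (G : SimpleGraph V) [DecidableRel G.Adj]

theorem choiceProb_nonneg (α β : ℝ) (S : Finset V) (i : V) (a : Profile V) (c : Action) :
    0 ≤ choiceProb G α β S i a c := by
  unfold choiceProb
  positivity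

theorem sum_choiceProb (α β : ℝ) (S : Finset V) (i : V) (a : Profile V) :
    ∑ c, choiceProb G α β S i a c = 1 := by
  rw [sum_action]
  unfold choiceProb
  rw [← add_div]
  exact div_self (by positivity)

/-- Each of the two terms of the denominator is at most `exp (β r)` times the numerator. -/
theorem exp_neg_div_two_le_choiceProb {α β r : ℝ} (hβ : 0 ≤ β) {S : Finset V} {i : V}
    {a : Profile V} {t : Action}
    (h : ∀ c, influencedUtility G α S i (Function.update a i c) ≤
      influencedUtility G α S i (Function.update a i t) + r) :
    Real.exp (-(β * r)) / 2 ≤ choiceProb G α β S i a t := by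
  have hexp : ∀ c, Real.exp (β * influencedUtility G α S i (Function.update a i c)) ≤
      Real.exp (β * r) * Real.exp (β * influencedUtility G α S i (Function.update a i t)) := by
    intro c
    rw [← Real.exp_add]
    apply Real.exp_le_exp.2
    nlinarith [mul_le_mul_of_nonneg_left (h c) hβ]
  unfold choiceProb
  rw [div_le_div_iff₀ two_pos (by positivity), Real.exp_neg, inv_mul_le_iff₀ (by positivity)]
  linarith [hexp Action.x, hexp Action.y]

theorem one_sub_exp_neg_le_choiceProb {α β s : ℝ} (hβ : 0 ≤ β) {S : Finset V} {i : V}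
    {a : Profile V} {t : Action}
    (h : ∀ c, c ≠ t → influencedUtility G α S i (Function.update a i c) + s ≤
      influencedUtility G α S i (Function.update a i t)) :
    1 - Real.exp (-(β * s)) ≤ choiceProb G α β S i a t := by
  have hexp : ∀ c, c ≠ t →
      Real.exp (β * influencedUtility G α S i (Function.update a i c)) ≤
      Real.exp (-(β * s)) *
        Real.exp (β * influencedUtility G α S i (Function.update a i t)) := by
    intro c hc
    rw [← Real.exp_add]
    apply Real.exp_le_exp.2
    nlinarith [mul_le_mul_of_nonneg_left (h c hc) hβ]
  have hs := Real.exp_pos (-(β * s))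
  unfold choiceProb
  rw [le_div_iff₀ (by positivity)]
  cases t with
  | x =>
    have h1 := hexp Action.y (by decide)
    have h2 : 0 < Real.exp (β * influencedUtility G α S i (Function.update a i Action.y)) :=
      Real.exp_pos _
    nlinarith
  | y =>
    have h1 := hexp Action.x (by decide)
    have h2 : 0 < Real.exp (β * influencedUtility G α S i (Function.update a i Action.x)) :=
      Real.exp_pos _
    nlinarith

theorem transition_mem_rowStochastic [Nonempty V] (α β : ℝ) (σ : Policy V) :
    transition G α β σ ∈ Matrix.rowStochastic ℝ (Profile V) := by
  rw [Matrix.mem_rowStochastic_iff_sum]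
  refine ⟨fun a b => ?_, fun a => ?_⟩
  · refine Finset.sum_nonneg fun i _ => mul_nonneg (by positivity) ?_
    refine Finset.sum_nonneg fun S _ => mul_nonneg (stdSimplex.zero_le (σ a) S) ?_
    refine Finset.sum_nonneg fun c _ => ?_
    split_ifs
    · exact choiceProb_nonneg G α β S i a c
    · exact le_rfl
  · have hrevise : ∀ i S, ∑ b : Profile V, ∑ c : Action,
        (if Function.update a i c = b then choiceProb G α β S i a c else 0) = 1 := by
      intro i S
      rw [Finset.sum_comm]
      simp [sum_choiceProb]
    unfold transition
    rw [Finset.sum_comm]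
    simp_rw [← Finset.mul_sum]
    rw [Finset.sum_congr rfl fun i _ => Finset.sum_comm]
    simp_rw [← Finset.mul_sum, hrevise, mul_one, stdSimplex.sum_eq_one]
    simp

theorem mul_choiceProb_div_le_transition {α β : ℝ} {σ : Policy V} (a : Profile V) (i : V)
    (S : Finset V) (c : Action) :
    σ a S * choiceProb G α β S i a c / Fintype.card V ≤
      transition G α β σ a (Function.update a i c) := by
  have h3 : ∀ j S', ∀ c' ∈ (Finset.univ : Finset Action),
      0 ≤ (if Function.update a j c' = Function.update a i c then
        choiceProb G α β S' j a c' else 0) := by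
    intro j S' c' _
    split_ifs
    · exact choiceProb_nonneg G α β S' j a c'
    · exact le_rfl
  have h2 : ∀ j, ∀ S' ∈ (Finset.univ : Finset (Finset V)), 0 ≤ σ a S' * ∑ c' : Action,
      (if Function.update a j c' = Function.update a i c then
        choiceProb G α β S' j a c' else 0) :=
    fun j S' _ => mul_nonneg (stdSimplex.zero_le (σ a) S') (Finset.sum_nonneg (h3 j S'))
  have h1 : ∀ j ∈ (Finset.univ : Finset V), 0 ≤ 1 / (Fintype.card V : ℝ) *
      ∑ S' : Finset V, σ a S' * ∑ c' : Action,
      (if Function.update a j c' = Function.update a i c then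
        choiceProb G α β S' j a c' else 0) :=
    fun j _ => mul_nonneg (by positivity) (Finset.sum_nonneg (h2 j))
  refine le_trans ?_ (Finset.single_le_sum h1 (Finset.mem_univ i))
  rw [div_eq_mul_inv, mul_comm, ← one_div]
  refine mul_le_mul_of_nonneg_left ?_ (by positivity)
  refine le_trans ?_ (Finset.single_le_sum (h2 i) (Finset.mem_univ S))
  refine mul_le_mul_of_nonneg_left ?_ (stdSimplex.zero_le (σ a) S)
  refine le_trans ?_ (Finset.single_le_sum (h3 i S) (Finset.mem_univ c))
  rw [if_pos rfl]

theorem le_transition_self [Nonempty V] {α β q : ℝ} {σ : Policy V} {a : Profile V}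
    (h : ∀ i S, σ a S ≠ 0 → q ≤ choiceProb G α β S i a (a i)) :
    q ≤ transition G α β σ a a := by
  have hS : ∀ i, q ≤ ∑ S : Finset V, σ a S * ∑ c : Action,
      (if Function.update a i c = a then choiceProb G α β S i a c else 0) := by
    intro i
    calc q = ∑ S : Finset V, σ a S * q := by
          rw [← Finset.sum_mul, stdSimplex.sum_eq_one, one_mul]
      _ ≤ _ := by
          refine Finset.sum_le_sum fun S _ => ?_
          by_cases hS : σ a S = 0
          · simp [hS]
          refine mul_le_mul_of_nonneg_left ((h i S hS).trans ?_) (stdSimplex.zero_le (σ a) S)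
          have hc : ∀ c ∈ (Finset.univ : Finset Action),
              0 ≤ (if Function.update a i c = a then choiceProb G α β S i a c else 0) := by
            intro c _
            split_ifs
            · exact choiceProb_nonneg G α β S i a c
            · exact le_rfl
          refine le_trans ?_ (Finset.single_le_sum hc (Finset.mem_univ (a i)))
          rw [if_pos (Function.update_eq_self i a)]
  calc q = ∑ _i : V, 1 / (Fintype.card V : ℝ) * q := by
        simp
    _ ≤ _ := Finset.sum_le_sum fun i _ => mul_le_mul_of_nonneg_left (hS i) (by positivity)

end

end CoordGame

/-! ### Path bounds and the cost criterion for stability -/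

theorem Matrix.mul_apply_le_pow_succ_apply {ι : Type*} [Fintype ι] [DecidableEq ι]
    {P : Matrix ι ι ℝ} (hP : P ∈ Matrix.rowStochastic ℝ ι) (m : ℕ) (a b c : ι) :
    P a b * (P ^ m) b c ≤ (P ^ (m + 1)) a c := by
  rw [pow_succ', Matrix.mul_apply]
  exact Finset.single_le_sum (f := fun b => P a b * (P ^ m) b c)
    (fun d _ => mul_nonneg (Matrix.nonneg_of_mem_rowStochastic hP)
      (Matrix.nonneg_of_mem_rowStochastic (pow_mem hP m))) (Finset.mem_univ b)

theorem Matrix.pow_le_pow_apply_self {ι : Type*} [Fintype ι] [DecidableEq ι]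
    {P : Matrix ι ι ℝ} (hP : P ∈ Matrix.rowStochastic ℝ ι) {q : ℝ} (hq : 0 ≤ q) {a : ι}
    (h : q ≤ P a a) (m : ℕ) : q ^ m ≤ (P ^ m) a a := by
  induction m with
  | zero => simp
  | succ m ih =>
    rw [pow_succ']
    exact (mul_le_mul h ih (by positivity) (hq.trans h)).trans
      (Matrix.mul_apply_le_pow_succ_apply hP m a a a)

namespace CoordGame

theorem exists_adj_of_ne {V : Type*} (G : SimpleGraph V) (hG : G.Connected) {a : Profile V} {t : Action}
    (ht : ∃ j, a j = t) (hne : ∃ i, a i ≠ t) : ∃ i, a i ≠ t ∧ ∃ j, G.Adj i j ∧ a j = t := by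
  obtain ⟨j, hj⟩ := ht
  obtain ⟨i, hi⟩ := hne
  obtain ⟨p⟩ := hG.preconnected i j
  obtain ⟨d, -, h1, h2⟩ := p.exists_boundary_dart {v | a v ≠ t} hi (by simpa using hj)
  exact ⟨d.fst, h1, d.snd, d.adj, by simpa using h2⟩

/-- By connectedness some agent not playing `t` has a neighbor playing `t`; switching it shrinks the
set of dissenters. Spare steps are spent at the consensus, so the exponent is exactly `m`. -/
theorem pow_le_pow_apply_of_growth {V : Type*} [Fintype V] [DecidableEq V] (G : SimpleGraph V)
    (hG : G.Connected) {t : Action}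
    {P : Matrix (Profile V) (Profile V) ℝ} (hP : P ∈ Matrix.rowStochastic ℝ (Profile V))
    {c : ℝ} (hc : 0 ≤ c) (hself : c ≤ P (fun _ => t) (fun _ => t))
    (hgrow : ∀ (a : Profile V) (i : V), (∃ j, G.Adj i j ∧ a j = t) →
      c ≤ P a (Function.update a i t)) (m : ℕ) (a : Profile V) (ht : ∃ j, a j = t)
    (hm : (Finset.univ.filter fun i => a i ≠ t).card ≤ m) :
    c ^ m ≤ (P ^ m) a (fun _ => t) := by
  induction m generalizing a with
  | zero =>
    have ha : a = fun _ => t := by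
      funext i
      by_contra hi
      have : i ∈ Finset.univ.filter fun i => a i ≠ t := by simpa using hi
      have := Finset.card_pos.2 ⟨i, this⟩
      omega
    simp [ha]
  | succ m ih =>
    by_cases hne : ∃ i, a i ≠ t
    · obtain ⟨i, hi, j, hij, hj⟩ := exists_adj_of_ne G hG ht hne
      have hlt : (Finset.univ.filter fun k => Function.update a i t k ≠ t).card <
          (Finset.univ.filter fun k => a k ≠ t).card := by
        apply Finset.card_lt_card
        refine (Finset.ssubset_iff_of_subset ?_).2 ⟨i, by simpa using hi, by simp⟩
        intro k hk
        rcases eq_or_ne k i with rfl | hki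
        · simp at hk
        · simpa [hki] using hk
      have hrest := ih (Function.update a i t) ⟨i, by simp⟩ (by omega)
      rw [pow_succ']
      exact (mul_le_mul (hgrow a i ⟨j, hij, hj⟩) hrest (by positivity)
        (Matrix.nonneg_of_mem_rowStochastic hP)).trans
        (Matrix.mul_apply_le_pow_succ_apply hP m a _ _)
    · push Not at hne
      obtain rfl : a = fun _ => t := funext hne
      exact Matrix.pow_le_pow_apply_self hP hc hself (m + 1)

open Filter Topology in
/-- If leaving the consensus on `t` costs at least `s`, the consensus on the other action can be
left at cost at most `r < s`, and every agent with a neighbor playing `t` switches to `t` for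
free under some influence set, then the consensus on `t` is strictly stochastically stable. -/
theorem strictlyStochasticallyStable_of_cost_lt {V : Type*} [Fintype V] [DecidableEq V]
    [Nonempty V] (G : SimpleGraph V) [DecidableRel G.Adj] (hG : G.Connected) {α r s : ℝ}
    {k : ℕ} (hk : k ≤ Fintype.card V) {σ : Policy V} (hσ : σ ∈ UR V k) {t o : Action}
    (hot : ∀ c, c ≠ t → c = o) (hr : 0 ≤ r) (hrs : r < s)
    (hstay : ∀ (S : Finset V) (i : V), S.card = k → ∀ c, c ≠ t →
      influencedUtility G α S i (Function.update (fun _ => t) i c) + s ≤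
        influencedUtility G α S i (Function.update (fun _ => t) i t))
    (hgrow : ∀ (a : Profile V) (i : V), (∃ j, G.Adj i j ∧ a j = t) →
      ∃ S : Finset V, S.card = k ∧ ∀ c, influencedUtility G α S i (Function.update a i c) ≤
        influencedUtility G α S i (Function.update a i t))
    (hleave : ∃ (i : V) (S : Finset V), S.card = k ∧ ∀ c,
      influencedUtility G α S i (Function.update (fun _ => o) i c) ≤
        influencedUtility G α S i (Function.update (fun _ => o) i t) + r) :
    StrictlyStochasticallyStable G α σ (fun _ => t) := by
  intro ε hε
  set n := Fintype.card V with hn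
  have hn0 : 0 < n := Fintype.card_pos
  set γ : ℝ := 1 / (n.choose k : ℝ) with hγ
  have hγ0 : 0 < γ := by
    have : 0 < n.choose k := Nat.choose_pos hk
    positivity
  have hγ1 : γ ≤ 1 := by
    have : (1 : ℝ) ≤ n.choose k := by exact_mod_cast Nat.choose_pos hk
    exact (div_le_one (by linarith)).2 this
  have hσk : ∀ (a : Profile V) (S : Finset V), S.card = k → σ a S = γ := by
    intro a S hS
    rw [hσ a S, if_pos hS]
  have hσ0 : ∀ (a : Profile V) (S : Finset V), σ a S ≠ 0 → S.card = k := by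
    intro a S h
    by_contra hS
    exact h (by rw [hσ a S, if_neg hS])
  -- A bound free of `β` for a costless move: `1 / n` for the agent, `γ` for the influence set, `1 /
  -- 2` for the choice.
  set c : ℝ := γ / (2 * n) with hc
  have hc0 : 0 < c := by positivity
  have hc1 : c ≤ 1 / 2 := by
    have : (1 : ℝ) ≤ n := by exact_mod_cast hn0
    rw [hc, div_le_div_iff₀ (by positivity) two_pos]
    nlinarith
  have hlim : Tendsto (fun β : ℝ => n / c ^ n * Real.exp (-(β * (s - r)))) atTop (𝓝 0) := by
    have h1 : Tendsto (fun β : ℝ => β * (s - r)) atTop atTop :=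
      tendsto_id.atTop_mul_const (sub_pos.2 hrs)
    simpa using (Real.tendsto_exp_neg_atTop_nhds_zero.comp h1).const_mul ((n : ℝ) / c ^ n)
  obtain ⟨B, hB⟩ := eventually_atTop.1 (hlim.eventually (gt_mem_nhds hε))
  refine ⟨max B 0, fun β hβ => ?_⟩
  have hβ0 : 0 ≤ β := (le_max_right B 0).trans hβ.le
  have hP := transition_mem_rowStochastic G α β σ
  set P := transition G α β σ
  have hself : 1 - Real.exp (-(β * s)) ≤ P (fun _ => t) (fun _ => t) :=
    le_transition_self G fun i S hS =>
      one_sub_exp_neg_le_choiceProb G hβ0 (hstay S i (hσ0 _ S hS))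
  have hself' : c ≤ P (fun _ => t) (fun _ => t) := by
    refine hc1.trans (le_transition_self G fun i S hS => ?_)
    have := exp_neg_div_two_le_choiceProb G (α := α) (r := 0) hβ0 (S := S) (i := i)
      (a := fun _ => t) (t := t) fun d => by
        rcases eq_or_ne d t with rfl | hd
        · simp
        · linarith [hstay S i (hσ0 _ S hS) d hd]
    simpa using this
  have hgrow' : ∀ (a : Profile V) (i : V), (∃ j, G.Adj i j ∧ a j = t) →
      c ≤ P a (Function.update a i t) := by
    intro a i h
    obtain ⟨S, hS, hU⟩ := hgrow a i h
    have h1 := exp_neg_div_two_le_choiceProb G (α := α) (r := 0) hβ0 (S := S) (i := i)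
      (a := a) (t := t) (by simpa using hU)
    have h2 := mul_choiceProb_div_le_transition G (α := α) (β := β) (σ := σ) a i S t
    rw [hσk a S hS] at h2
    refine le_trans ?_ h2
    rw [hc, ← div_div]
    gcongr
    have h3 := mul_le_mul_of_nonneg_left h1 hγ0.le
    simp only [mul_zero, neg_zero, Real.exp_zero] at h3
    linarith
  have hreach : ∀ a, c ^ n * Real.exp (-(β * r)) ≤ (P ^ n) a (fun _ => t) := by
    intro a
    by_cases ha : ∃ j, a j = t
    · have h1 := pow_le_pow_apply_of_growth G hG hP hc0.le hself' hgrow' n a ha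
        ((Finset.card_filter_le _ _).trans (by simp [hn]))
      have h2 : Real.exp (-(β * r)) ≤ 1 :=
        Real.exp_le_one_iff.2 (neg_nonpos.2 (mul_nonneg hβ0 hr))
      exact (mul_le_of_le_one_right (by positivity) h2).trans h1
    -- Nobody plays `t`: one paid step creates a first such agent, and the other `n - 1` steps are
    -- free.
    · push Not at ha
      obtain rfl : a = fun _ => o := funext fun j => hot _ (ha j)
      obtain ⟨i, S, hS, hU⟩ := hleave
      have h1 := exp_neg_div_two_le_choiceProb G hβ0 hU
      have h2 := mul_choiceProb_div_le_transition G (α := α) (β := β) (σ := σ)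
        (fun _ => o) i S t
      rw [hσk _ S hS] at h2
      have h3 : c * Real.exp (-(β * r)) ≤
          P (fun _ => o) (Function.update (fun _ => o) i t) := by
        refine le_trans ?_ h2
        rw [hc, div_mul_eq_mul_div, ← div_div]
        gcongr
        have h3 := mul_le_mul_of_nonneg_left h1 hγ0.le
        linarith
      obtain ⟨m, hm⟩ : ∃ m, n = m + 1 := ⟨n - 1, by omega⟩
      have h4 := pow_le_pow_apply_of_growth G hG hP hc0.le hself' hgrow' m
        (Function.update (fun _ => o) i t) ⟨i, by simp⟩ (by
          have : (Finset.univ.filter fun j =>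
              Function.update (fun _ => o) i t j ≠ t) ⊆ Finset.univ.erase i := by
            intro j hj
            refine Finset.mem_erase.2 ⟨?_, Finset.mem_univ j⟩
            rintro rfl
            simp at hj
          refine (Finset.card_le_card this).trans ?_
          rw [Finset.card_erase_of_mem (Finset.mem_univ i), Finset.card_univ]
          omega)
      rw [hm, pow_succ', mul_right_comm]
      exact (mul_le_mul h3 h4 (by positivity)
        (Matrix.nonneg_of_mem_rowStochastic hP)).trans
        (Matrix.mul_apply_le_pow_succ_apply hP m _ _ _)
  have hη : Real.exp (-(β * s)) ≤ 1 :=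
    Real.exp_le_one_iff.2 (neg_nonpos.2 (mul_nonneg hβ0 (hr.trans hrs.le)))
  have hback : 1 - n * Real.exp (-(β * s)) ≤ (P ^ n) (fun _ => t) (fun _ => t) := by
    refine le_trans ?_ (Matrix.pow_le_pow_apply_self hP (sub_nonneg.2 hη) hself n)
    -- Bernoulli's inequality.
    have := one_add_mul_le_pow (a := -Real.exp (-(β * s))) (by linarith) n
    rw [← sub_eq_add_neg] at this
    linarith
  refine Matrix.exists_forall_lt_pow_apply hP hn0 (by positivity) (by positivity) hreach hback ?_
  have hratio : n * Real.exp (-(β * s)) / (c ^ n * Real.exp (-(β * r))) =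
      n / c ^ n * Real.exp (-(β * (s - r))) := by
    rw [mul_div_mul_comm, ← Real.exp_sub]
    ring_nf
  rw [hratio]
  exact hB β ((le_max_left B 0).trans hβ.le)

end CoordGame

/-! ### Costs on graphs of degree two -/

namespace CoordGame

section

variable {V : Type*} [Fintype V] [DecidableEq V] (G : SimpleGraph V) [DecidableRel G.Adj]

theorem influencedUtility_update_x (α : ℝ) (S : Finset V) (i : V) (a : Profile V) :
    influencedUtility G α S i (Function.update a i Action.x) =
      (1 + α) * ((G.neighborFinset i).filter fun j => a j = Action.x).card := by
  have h : ∀ j ∈ G.neighborFinset i, payoff α (Function.update a i Action.x i)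
      (Function.update a i Action.x j) = if a j = Action.x then 1 + α else 0 := by
    intro j hj
    have hji : j ≠ i := ((G.mem_neighborFinset i j).1 hj).ne'
    rw [Function.update_self, Function.update_of_ne hji]
    cases a j <;> simp [payoff]
  unfold influencedUtility utility
  rw [Finset.sum_congr rfl h, ← Finset.sum_filter, Finset.sum_const, nsmul_eq_mul, mul_comm]
  simp

theorem influencedUtility_update_y (α : ℝ) (S : Finset V) (i : V) (a : Profile V) :
    influencedUtility G α S i (Function.update a i Action.y) =
      ((G.neighborFinset i).filter fun j => a j = Action.y).card + if i ∈ S then 1 else 0 := by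
  have h : ∀ j ∈ G.neighborFinset i, payoff α (Function.update a i Action.y i)
      (Function.update a i Action.y j) = if a j = Action.y then 1 else 0 := by
    intro j hj
    have hji : j ≠ i := ((G.mem_neighborFinset i j).1 hj).ne'
    rw [Function.update_self, Function.update_of_ne hji]
    cases a j <;> simp [payoff]
  unfold influencedUtility utility
  rw [Finset.sum_congr rfl h, ← Finset.sum_filter]
  simp

theorem card_filter_x_add_card_filter_y {V : Type*} [Fintype V] (G : SimpleGraph V)
    [DecidableRel G.Adj] (i : V) (a : Profile V) :
    ((G.neighborFinset i).filter fun j => a j = Action.x).card +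
      ((G.neighborFinset i).filter fun j => a j = Action.y).card = G.degree i := by
  rw [← G.card_neighborFinset_eq_degree i,
    ← Finset.card_filter_add_card_filter_not (s := G.neighborFinset i) fun j => a j = Action.x]
  congr 2
  refine Finset.filter_congr fun j _ => ?_
  cases a j <;> simp

/-- On a connected graph of degree two, if every agent receives a bonus of at most `e` for some
influence set, then `α > (1 + e) / 2` makes the all-`x` joint action stable. -/
theorem strictlyStochasticallyStable_allX [Nonempty V] (hG : G.Connected)
    (hdeg : G.IsRegularOfDegree 2) {α e : ℝ} {k : ℕ} (hk : k ≤ Fintype.card V) {σ : Policy V}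
    (hσ : σ ∈ UR V k) (he0 : 0 ≤ e) (he1 : e ≤ 1)
    (hS : ∀ i : V, ∃ S : Finset V, S.card = k ∧ (if i ∈ S then (1 : ℝ) else 0) ≤ e)
    (hα : (1 + e) / 2 < α) : StrictlyStochasticallyStable G α σ (allX V) := by
  -- `s` is `2 * (1 + α)` minus the largest possible bonus `1`; `r` is two `y`-links plus a bonus of
  -- at most `e`.
  refine strictlyStochasticallyStable_of_cost_lt G hG (t := Action.x) (o := Action.y)
    (r := 2 + e) (s := 1 + 2 * α) hk hσ (fun c => by cases c <;> simp) (by linarith)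
    (by linarith) ?_ ?_ ?_
  · rintro S i - c hc
    cases c with
    | x => exact absurd rfl hc
    | y =>
      rw [influencedUtility_update_x, influencedUtility_update_y]
      simp only [reduceCtorEq, Finset.filter_true, Finset.filter_false, Finset.card_empty,
        SimpleGraph.card_neighborFinset_eq_degree, hdeg i]
      split_ifs <;> push_cast <;> linarith
  · rintro a i ⟨j, hij, hj⟩
    obtain ⟨S, hSk, hSi⟩ := hS i
    refine ⟨S, hSk, fun c => ?_⟩
    cases c with
    | x => exact le_rfl
    | y =>
      rw [influencedUtility_update_x, influencedUtility_update_y]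
      have hsum := card_filter_x_add_card_filter_y G i a
      rw [hdeg i] at hsum
      have hpos : 0 < ((G.neighborFinset i).filter fun j => a j = Action.x).card :=
        Finset.card_pos.2 ⟨j, by simpa [hj] using hij⟩
      have hpos' : (1 : ℝ) ≤ ((G.neighborFinset i).filter fun j => a j = Action.x).card := by
        exact_mod_cast hpos
      have hsum' : (((G.neighborFinset i).filter fun j => a j = Action.x).card : ℝ) +
          ((G.neighborFinset i).filter fun j => a j = Action.y).card = 2 := by
        exact_mod_cast hsum
      -- With one neighbor on each action the claim is `1 + e ≤ 1 + α`, true because `e ≤ (1 + e) /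
      -- 2 < α`.
      nlinarith
  · obtain ⟨i⟩ := ‹Nonempty V›
    obtain ⟨S, hSk, hSi⟩ := hS i
    refine ⟨i, S, hSk, fun c => ?_⟩
    cases c with
    | x => linarith
    | y =>
      rw [influencedUtility_update_x, influencedUtility_update_y]
      simp only [reduceCtorEq, Finset.filter_true, Finset.filter_false, Finset.card_empty,
        SimpleGraph.card_neighborFinset_eq_degree, hdeg i]
      push_cast
      linarith

/-- On a connected graph of degree two, if every agent receives a bonus of at least `e` for all
influence sets, then `α < (1 + e) / 2` makes the all-`y` joint action stable. -/
theorem strictlyStochasticallyStable_allY [Nonempty V] (hG : G.Connected)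
    (hdeg : G.IsRegularOfDegree 2) {α e : ℝ} {k : ℕ} (hk : k ≤ Fintype.card V) (hk0 : 1 ≤ k)
    {σ : Policy V} (hσ : σ ∈ UR V k) (he0 : 0 ≤ e) (he1 : e ≤ 1)
    (hS : ∀ (i : V) (S : Finset V), S.card = k → e ≤ if i ∈ S then (1 : ℝ) else 0)
    (hα : α < (1 + e) / 2) : StrictlyStochasticallyStable G α σ (allY V) := by
  have hmem : ∀ i : V, ∃ S : Finset V, S.card = k ∧ i ∈ S := by
    intro i
    obtain ⟨S, hiS, -, hSk⟩ := Finset.exists_subsuperset_card_eq (Finset.subset_univ {i})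
      (by simpa using hk0) (by simpa using hk)
    exact ⟨S, hSk, hiS (by simp)⟩
  -- Influencing the agent lowers the exit cost of all-`x` to `2 * (1 + α) - 1`, which is negative
  -- for `α < -1 / 2`; hence the maximum with `0`.
  refine strictlyStochasticallyStable_of_cost_lt G hG (t := Action.y) (o := Action.x)
    (r := max 0 (1 + 2 * α)) (s := 2 + e) hk hσ (fun c => by cases c <;> simp)
    (le_max_left _ _) (max_lt (by linarith) (by linarith)) ?_ ?_ ?_
  · intro S i hSk c hc
    cases c with
    | y => exact absurd rfl hc
    | x =>
      rw [influencedUtility_update_x, influencedUtility_update_y]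
      simp only [reduceCtorEq, Finset.filter_true, Finset.filter_false, Finset.card_empty,
        SimpleGraph.card_neighborFinset_eq_degree, hdeg i]
      have := hS i S hSk
      push_cast
      linarith
  · rintro a i ⟨j, hij, hj⟩
    obtain ⟨S, hSk, hSi⟩ := hmem i
    refine ⟨S, hSk, fun c => ?_⟩
    cases c with
    | y => exact le_rfl
    | x =>
      rw [influencedUtility_update_x, influencedUtility_update_y, if_pos hSi]
      have hsum := card_filter_x_add_card_filter_y G i a
      rw [hdeg i] at hsum
      have hpos : 0 < ((G.neighborFinset i).filter fun j => a j = Action.y).card :=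
        Finset.card_pos.2 ⟨j, by simpa [hj] using hij⟩
      have hpos' : (1 : ℝ) ≤ ((G.neighborFinset i).filter fun j => a j = Action.y).card := by
        exact_mod_cast hpos
      have hsum' : (((G.neighborFinset i).filter fun j => a j = Action.x).card : ℝ) +
          ((G.neighborFinset i).filter fun j => a j = Action.y).card = 2 := by
        exact_mod_cast hsum
      have hx : (0 : ℝ) ≤ ((G.neighborFinset i).filter fun j => a j = Action.x).card := by
        positivity
      -- The bonus makes `y` worth at least `2`, and `α < (1 + e) / 2 ≤ 1` keeps a single `x`-link
      -- below that.
      nlinarith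
  · obtain ⟨i⟩ := ‹Nonempty V›
    obtain ⟨S, hSk, hSi⟩ := hmem i
    refine ⟨i, S, hSk, fun c => ?_⟩
    cases c with
    | y => linarith [le_max_left 0 (1 + 2 * α)]
    | x =>
      rw [influencedUtility_update_x, influencedUtility_update_y, if_pos hSi]
      simp only [reduceCtorEq, Finset.filter_true, Finset.filter_false, Finset.card_empty,
        SimpleGraph.card_neighborFinset_eq_degree, hdeg i]
      push_cast
      linarith [le_max_right 0 (1 + 2 * α)]

/-! ### From stability to the thresholds -/

/-- Two distinct states cannot both have probability above `1 / 2` at a common time. -/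
theorem StrictlyStochasticallyStable.eq [Nonempty V] {α : ℝ} {σ : Policy V} {a b : Profile V}
    (ha : StrictlyStochasticallyStable G α σ a) (hb : StrictlyStochasticallyStable G α σ b) :
    a = b := by
  by_contra hab
  obtain ⟨B₁, h₁⟩ := ha (1 / 2) (by norm_num)
  obtain ⟨B₂, h₂⟩ := hb (1 / 2) (by norm_num)
  obtain ⟨T₁, h₁⟩ := h₁ (max B₁ B₂ + 1) ((le_max_left _ _).trans_lt (lt_add_one _))
  obtain ⟨T₂, h₂⟩ := h₂ (max B₁ B₂ + 1) ((le_max_right _ _).trans_lt (lt_add_one _))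
  have h₁ := h₁ a (max T₁ T₂ + 1) (by omega)
  have h₂ := h₂ a (max T₁ T₂ + 1) (by omega)
  have hP := pow_mem (transition_mem_rowStochastic G α (max B₁ B₂ + 1) σ) (max T₁ T₂ + 1)
  have hle := Finset.sum_le_univ_sum_of_nonneg (s := {a, b})
    fun c => Matrix.nonneg_of_mem_rowStochastic hP (i := a) (j := c)
  rw [Matrix.sum_row_of_mem_rowStochastic hP, Finset.sum_pair hab] at hle
  unfold probAt at h₁ h₂
  linarith

/-- Excludes vacuous resilience, and supplies the policy that susceptibility asks for. -/
theorem nonempty_UR {V : Type*} [Fintype V] {k : ℕ} (hk : k ≤ Fintype.card V) : (UR V k).Nonempty := by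
  refine ⟨fun _ => ⟨fun S => if S.card = k then 1 / ((Fintype.card V).choose k : ℝ) else 0,
    fun S => ?_, ?_⟩, fun a S => rfl⟩
  · dsimp only
    split_ifs <;> positivity
  · have : ((Fintype.card V).choose k : ℝ) ≠ 0 := by
      exact_mod_cast (Nat.choose_pos hk).ne'
    rw [← Finset.sum_filter, Finset.univ_filter_card_eq, Finset.sum_const,
      Finset.card_powersetCard, Finset.card_univ, nsmul_eq_mul, mul_one_div_cancel this]

theorem alphaResil_eq_and_alphaSus_eq [Nonempty V] {k : ℕ} (hk : k ≤ Fintype.card V) {τ : ℝ}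
    (hx : ∀ α, τ < α → ∀ σ ∈ UR V k, StrictlyStochasticallyStable G α σ (allX V))
    (hy : ∀ α, α < τ → ∀ σ ∈ UR V k, StrictlyStochasticallyStable G α σ (allY V)) :
    alphaResil G (UR V k) = τ ∧ alphaSus G (UR V k) = τ := by
  obtain ⟨σ, hσ⟩ := nonempty_UR (V := V) hk
  have hne : allX V ≠ allY V := fun h => by
    obtain ⟨i⟩ := ‹Nonempty V›
    exact absurd (congrFun h i) (by simp [allX, allY])
  constructor
  · refine IsGLB.sInf_eq ⟨?_, fun b hb => ?_⟩
    · rintro _ ⟨α, hα, rfl⟩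
      refine EReal.coe_le_coe_iff.2 (not_lt.1 fun h => hne ?_)
      exact StrictlyStochasticallyStable.eq G (hα σ hσ) (hy α h σ hσ)
    · refine EReal.le_of_forall_lt_iff_le.1 fun α hα => hb ⟨α, ?_, rfl⟩
      exact hx α (EReal.coe_lt_coe_iff.1 hα)
  · refine IsLUB.sSup_eq ⟨?_, fun b hb => ?_⟩
    · rintro _ ⟨α, ⟨ρ, hρ, hα⟩, rfl⟩
      refine EReal.coe_le_coe_iff.2 (not_lt.1 fun h => hne ?_)
      exact StrictlyStochasticallyStable.eq G (hx α h ρ hρ) hα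
    · refine EReal.ge_of_forall_gt_iff_ge.1 fun α hα => hb ⟨α, ⟨σ, hσ, ?_⟩, rfl⟩
      exact hy α (EReal.coe_lt_coe_iff.1 hα) σ hσ

theorem alphaResil_eq_and_alphaSus_eq_of_isRegularOfDegree_two [Nonempty V] (hG : G.Connected)
    (hdeg : G.IsRegularOfDegree 2) {k : ℕ} (hk0 : 1 ≤ k) (hk : k ≤ Fintype.card V) :
    alphaResil G (UR V k) = ((if k = Fintype.card V then 1 else 1 / 2 : ℝ) : EReal) ∧
      alphaSus G (UR V k) = ((if k = Fintype.card V then 1 else 1 / 2 : ℝ) : EReal) := by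
  -- For `k = n` the only influence set is everyone, so `e = 1` works on both sides; for `k < n` a
  -- set avoiding the agent gives `e = 0`.
  apply alphaResil_eq_and_alphaSus_eq G hk
  · intro α hα σ hσ
    split_ifs at hα with hkn
    · exact strictlyStochasticallyStable_allX G hG hdeg hk hσ zero_le_one le_rfl
        (fun i => ⟨Finset.univ, by simp [hkn]⟩) (by linarith)
    · refine strictlyStochasticallyStable_allX G hG hdeg hk hσ le_rfl zero_le_one
        (fun i => ?_) (by linarith)
      obtain ⟨S, hiS, hSk⟩ := Finset.exists_subset_card_eq
        (s := Finset.univ.erase i) (n := k) (by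
          rw [Finset.card_erase_of_mem (Finset.mem_univ i), Finset.card_univ]
          omega)
      have hi : i ∉ S := fun h => by simpa using hiS h
      exact ⟨S, hSk, by simp [hi]⟩
  · intro α hα σ hσ
    split_ifs at hα with hkn
    · refine strictlyStochasticallyStable_allY G hG hdeg hk hk0 hσ zero_le_one le_rfl
        (fun i S hSk => ?_) (by linarith)
      rw [Finset.card_eq_iff_eq_univ S |>.1 (hSk.trans hkn)]
      simp
    · refine strictlyStochasticallyStable_allY G hG hdeg hk hk0 hσ le_rfl zero_le_one
        (fun i S _ => ?_) (by linarith)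
      split_ifs <;> norm_num

end

end CoordGame

theorem theorem4 (n k : ℕ) (hn : 3 ≤ n) (hk : 1 ≤ k) (hkn : k ≤ n) :
    CoordGame.alphaResil (SimpleGraph.cycleGraph n) (CoordGame.UR (Fin n) k) =
        CoordGame.alphaSus (SimpleGraph.cycleGraph n) (CoordGame.UR (Fin n) k) ∧
      CoordGame.alphaSus (SimpleGraph.cycleGraph n) (CoordGame.UR (Fin n) k) =
        if k = n then ((1 : ℝ) : EReal) else ((1 / 2 : ℝ) : EReal) := by
  obtain ⟨m, rfl⟩ : ∃ m, n = m + 3 := ⟨n - 3, by omega⟩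
  obtain ⟨h1, h2⟩ := CoordGame.alphaResil_eq_and_alphaSus_eq_of_isRegularOfDegree_two
    (SimpleGraph.cycleGraph (m + 3)) SimpleGraph.cycleGraph_connected
    (fun v => by convert SimpleGraph.cycleGraph_degree_three_le (v := v)) hk (by simpa using hkn)
  refine ⟨h1.trans h2.symm, h2.trans ?_⟩
  rw [Fintype.card_fin, apply_ite Real.toEReal]
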